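/- Let $d,s\ge 0$ be integers, $v\in\mathbb{R}^d$ and $h(x)=\|x-v\|_2^2$. Let $g_1,\dots,g_s\in\mathbb{R}[x_1,\dots,x_d]$ be SOS-convex polynomials, that is, for each $j$ the Hessian satisfies $\nabla^2 g_j(x)=P_j(x)^\top P_j(x)$ for some matrix $P_j$ of polynomials with $d$ columns. Let $\mathcal{D}=\{x\in\mathbb{R}^d : g_j(x)\le 0,\ j=1,\dots,s\}$. Let $\omega$ be the smallest even integer with $\omega\ge 2$ and $\omega\ge\deg g_j$ for all $j$. For $n\ge0$ put $\mathbf{N}_n^d=\{\alpha\in\mathbb{Z}_{\ge0}^d : \alpha_1+\dots+\alpha_d\le n\}$, let $f_\alpha$ denote the coefficient of $x^\alpha$ in a polynomial $f$, and for $\alpha\in\mathbf{N}_\omega^d$ let $B_\alpha$ be the symmetric matrix indexed by $\mathbf{N}_{\omega/2}^d$ with $(B_\alpha)_{\beta\gamma}=1$ if $\beta+\gamma=\alpha$ and $0$ otherwise. Consider the semidefinite programs $$(\mathrm{SDP}_v)\quad \max_{\lambda\in\mathbb{R}_+^s,\ \gamma\in\mathbb{R},\ Q\succeq0}\Big\{\gamma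 : h_\alpha+\sum_{j=1}^s\lambda_j(g_j)_\alpha-\gamma q_\alpha=\mathrm{tr}(QB_\alpha),\ \alpha\in\mathbf{N}_\omega^d\Big\},$$ where $Q$ is a real symmetric matrix indexed by $\mathbf{N}_{\omega/2}^d$, $q_0=1$ and $q_\alpha=0$ for $\alpha\ne0$, and $$(\mathrm{MP}_v)\quad \min_{y\in\mathbb{R}^{\mathbf{N}_\omega^d}}\Big\{\sum_{\alpha\in\mathbf{N}_\omega^d}h_\alpha y_\alpha : \sum_{\alpha\in\mathbf{N}_\omega^d}(g_j)_\alpha y_\alpha\le0,\ j=1,\dots,s,\ \sum_{\alpha\in\mathbf{N}_\omega^d}y_\alpha B_\alpha\succeq0,\ y_0=1\Big\}.$$ Assume that both optimal values are attained and $\max(\mathrm{SDP}_v)=\min(\mathrm{MP}_v)$, and let $y^*$ be an optimal solution of $(\mathrm{MP}_v)$. Then the Euclidean projection of $v$ onto $\mathcal{D}$ is $$P_{\mathcal{D}}(v)=(y^*_{e_1},\dots,y^*_{e_d}),$$ where $e_i$ is the $i$-th unit multi-index; that is, the right-hand side is the unique minimiser of $\|v-x\|_2^2$ over $x\in\mathcal{D}$.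 -/

import Mathlib

namespace SOSProj

open MvPolynomial

noncomputable section

/-- The Hessian of a polynomial, as a matrix of polynomials. -/
def hessian {d : ℕ} (f : MvPolynomial (Fin d) ℝ) :
    Matrix (Fin d) (Fin d) (MvPolynomial (Fin d) ℝ) :=
  Matrix.of fun i j => pderiv i (pderiv j f)

/-- `f` is SOS-convex: its Hessian equals `Pᵀ P` for some `ν × d` polynomial matrix `P`. -/
def IsSOSConvex {d : ℕ} (f : MvPolynomial (Fin d) ℝ) : Prop :=
  ∃ (ν : ℕ) (P : Matrix (Fin ν) (Fin d) (MvPolynomial (Fin d) ℝ)),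
    hessian f = P.transpose * P

/-- The set `{x ∈ ℝ^d : g_j(x) ≤ 0 for all j}`. -/
def feasibleSet {d s : ℕ} (g : Fin s → MvPolynomial (Fin d) ℝ) :
    Set (EuclideanSpace ℝ (Fin d)) :=
  {x | ∀ j, eval (fun i => x i) (g j) ≤ 0}

/-- The minimisers of `x ↦ ‖v - x‖²` over `D`. The equation `P_D(v) = p` means that this set
is `{p}`. -/
def projectionSet {d : ℕ} (D : Set (EuclideanSpace ℝ (Fin d))) (v : EuclideanSpace ℝ (Fin d)) :
    Set (EuclideanSpace ℝ (Fin d)) :=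
  {p | p ∈ D ∧ ∀ x ∈ D, ‖v - p‖ ^ 2 ≤ ‖v - x‖ ^ 2}

/-- The polynomial `h(x) = ‖x - v‖²`. -/
def distSqPoly {d : ℕ} (v : EuclideanSpace ℝ (Fin d)) : MvPolynomial (Fin d) ℝ :=
  ∑ i, (X i - C (v i)) ^ 2

theorem eval_distSqPoly {d : ℕ} (v x : EuclideanSpace ℝ (Fin d)) :
    eval (fun i => x i) (distSqPoly v) = ‖x - v‖ ^ 2 := by
  simp [distSqPoly, EuclideanSpace.norm_sq_eq]

/-- The multi-indices `α ∈ ℕ^d` with `α_1 + ⋯ + α_d ≤ n`. -/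
def multiIdx (d n : ℕ) : Finset (Fin d →₀ ℕ) :=
  (Finset.range (n + 1)).biUnion fun k => Finset.finsuppAntidiag Finset.univ k

theorem mem_multiIdx {d n : ℕ} (α : Fin d →₀ ℕ) :
    α ∈ multiIdx d n ↔ ∑ i, α i ≤ n := by
  simp [multiIdx, Finset.mem_finsuppAntidiag]

theorem zero_mem_multiIdx (d n : ℕ) : (0 : Fin d →₀ ℕ) ∈ multiIdx d n := by
  simp [mem_multiIdx]

theorem single_mem_multiIdx {d n : ℕ} (hn : 2 ≤ n) (i : Fin d) :
    Finsupp.single i 1 ∈ multiIdx d n := by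
  rw [mem_multiIdx, Finset.sum_eq_single i]
  · simp; omega
  · intro j _ hj
    simp [hj.symm]
  · simp

/-- The matrix `B_α`, indexed by the multi-indices of order at most `n`: it is determined by
`(x^β x^γ)_{β,γ} = ∑_α x^α B_α`. -/
def momentBasis {d : ℕ} (n : ℕ) (α : Fin d →₀ ℕ) :
    Matrix (multiIdx d n) (multiIdx d n) ℝ :=
  Matrix.of fun β γ => if (β : Fin d →₀ ℕ) + γ = α then 1 else 0

/-- The Riesz functional `L_y(f) = ∑_{|α| ≤ ω} f_α y_α`. -/
def riesz {d ω : ℕ} (y : multiIdx d ω → ℝ) (f : MvPolynomial (Fin d) ℝ) : ℝ :=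
  ∑ α : multiIdx d ω, coeff (α : Fin d →₀ ℕ) f * y α

/-- The feasible points of the moment program: `L_y(g_j) ≤ 0` for all `j`,
`∑_α y_α B_α ⪰ 0` and `y_0 = 1`. -/
def momentFeasible {d s : ℕ} (g : Fin s → MvPolynomial (Fin d) ℝ) (ω : ℕ) :
    Set (multiIdx d ω → ℝ) :=
  {y | (∀ j, riesz y (g j) ≤ 0) ∧
    (∑ α : multiIdx d ω, y α • momentBasis (ω / 2) (α : Fin d →₀ ℕ)).PosSemidef ∧
    y ⟨0, zero_mem_multiIdx d ω⟩ = 1}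

/-- The objective values of the moment program. -/
def momentValues {d s : ℕ} (g : Fin s → MvPolynomial (Fin d) ℝ)
    (v : EuclideanSpace ℝ (Fin d)) (ω : ℕ) : Set ℝ :=
  (fun y => riesz y (distSqPoly v)) '' momentFeasible g ω

/-- `y` is an optimal solution of the moment program. -/
def IsMomentSolution {d s : ℕ} (g : Fin s → MvPolynomial (Fin d) ℝ)
    (v : EuclideanSpace ℝ (Fin d)) (ω : ℕ) (y : multiIdx d ω → ℝ) : Prop :=
  y ∈ momentFeasible g ω ∧
    ∀ z ∈ momentFeasible g ω, riesz y (distSqPoly v) ≤ riesz z (distSqPoly v)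

/-- The objective values `γ` of the sum-of-squares program: those for which there are `λ ≥ 0` and
`Q ⪰ 0` with `h_α + ∑_j λ_j (g_j)_α - γ q_α = tr(Q B_α)` for all `|α| ≤ ω`, where `q_0 = 1` and
`q_α = 0` for `α ≠ 0`. -/
def sosValues {d s : ℕ} (g : Fin s → MvPolynomial (Fin d) ℝ)
    (v : EuclideanSpace ℝ (Fin d)) (ω : ℕ) : Set ℝ :=
  {γ | ∃ (l : Fin s → ℝ) (Q : Matrix (multiIdx d (ω / 2)) (multiIdx d (ω / 2)) ℝ),
    (∀ j, 0 ≤ l j) ∧ Q.PosSemidef ∧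
    ∀ α ∈ multiIdx d ω,
      coeff α (distSqPoly v) + ∑ j, l j * coeff α (g j) - γ * (if α = 0 then 1 else 0) =
        (Q * momentBasis (ω / 2) α).trace}

end

end SOSProj

namespace SOSProj

open MvPolynomial

noncomputable section

/-! Write L for the Riesz functional of `y` and p for its first moments. The key is Jensen's
inequality f(p) ≤ L(f) for SOS-convex f (`IsSOSConvex.eval_le_riesz`). Put φ(t) = L(f(p + t(x -
p))), so φ(0) = f(p) and φ(1) = L(f). Then φ'(0) = 0 because L(x_i) = p_i, and φ'' is L of a sum of
squares, hence nonnegative. Positivity of the moment matrix only covers squares of polynomials of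
degree at most ω/2; `totalDegree_le_of_sum_mul_self` supplies that bound. Jensen for the g_j puts p
in D. Jensen for h gives ‖p - v‖² ≤ L(h), and L(h) ≤ ‖x - v‖² for x in D, since point masses on D
are feasible moments. Uniqueness follows from convexity of D. -/

/-- In a sum of squares of real polynomials the leading forms do not cancel. -/
theorem totalDegree_le_of_sum_mul_self {d ν n : ℕ} (q : Fin ν → MvPolynomial (Fin d) ℝ)
    (h : (∑ k, q k * q k).totalDegree ≤ 2 * n) (k : Fin ν) : (q k).totalDegree ≤ n := by
  -- A graded order, so the leading monomial realises the total degree.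
  let m : MonomialOrder (Fin d) := MonomialOrder.degLex
  obtain ⟨k₀, -, hk₀⟩ := Finset.exists_max_image Finset.univ
    (fun k => m.toSyn (m.degree (q k))) ⟨k, Finset.mem_univ k⟩
  set a := m.degree (q k₀) with ha
  have hle : (q k).totalDegree ≤ (q k₀).totalDegree :=
    degLex_totalDegree_monotone (hk₀ k (Finset.mem_univ k))
  refine hle.trans ?_
  by_cases h0 : q k₀ = 0
  · simp [h0]
  -- No `q j` has a monomial above `a`, so only `a + a` itself contributes.
  have hcoeff : coeff (a + a) (∑ k, q k * q k) = ∑ k, coeff a (q k) * coeff a (q k) := by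
    rw [coeff_sum]
    refine Finset.sum_congr rfl fun j _ => ?_
    exact m.coeff_mul_of_add_of_degree_le (hk₀ j (Finset.mem_univ j)) (hk₀ j (Finset.mem_univ j))
  have hlc : coeff a (q k₀) ≠ 0 := m.leadingCoeff_ne_zero_iff.mpr h0
  have hpos : 0 < coeff (a + a) (∑ k, q k * q k) := by
    rw [hcoeff]
    exact Finset.sum_pos' (fun j _ => mul_self_nonneg _)
      ⟨k₀, Finset.mem_univ _, mul_self_pos.mpr hlc⟩
  have hdeg := (le_totalDegree (mem_support_iff.mpr hpos.ne')).trans h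
  change (a + a).degree ≤ _ at hdeg
  have hdeg_a : a.degree = (q k₀).totalDegree := degree_degLexDegree
  rw [map_add] at hdeg
  omega

/-! ### Coefficientwise derivatives of curves of polynomials -/

/-- The curve `t ↦ F t` of polynomials has, coefficient by coefficient, the derivative `F'`
at `t`. -/
def HasCoeffDerivAt {σ : Type*} (F : ℝ → MvPolynomial σ ℝ) (F' : MvPolynomial σ ℝ) (t : ℝ) :
    Prop :=
  ∀ α, HasDerivAt (fun t => coeff α (F t)) (coeff α F') t

namespace HasCoeffDerivAt

variable {σ : Type*} {F G : ℝ → MvPolynomial σ ℝ} {F' G' : MvPolynomial σ ℝ} {t : ℝ}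

theorem const (p : MvPolynomial σ ℝ) (t : ℝ) : HasCoeffDerivAt (fun _ => p) 0 t := fun α => by
  simpa using hasDerivAt_const t (coeff α p)

theorem add (hF : HasCoeffDerivAt F F' t) (hG : HasCoeffDerivAt G G' t) :
    HasCoeffDerivAt (fun t => F t + G t) (F' + G') t := fun α => by
  simpa only [coeff_add] using (hF α).fun_add (hG α)

theorem mul (hF : HasCoeffDerivAt F F' t) (hG : HasCoeffDerivAt G G' t) :
    HasCoeffDerivAt (fun t => F t * G t) (F' * G t + F t * G') t := fun α => by
  classical
  simp only [coeff_add, coeff_mul, ← Finset.sum_add_distrib]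
  exact HasDerivAt.fun_sum fun a _ => (hF a.1).fun_mul (hG a.2)

theorem sum {ι : Type*} {s : Finset ι} {F : ι → ℝ → MvPolynomial σ ℝ}
    {F' : ι → MvPolynomial σ ℝ} (h : ∀ i ∈ s, HasCoeffDerivAt (F i) (F' i) t) :
    HasCoeffDerivAt (fun t => ∑ i ∈ s, F i t) (∑ i ∈ s, F' i) t := fun α => by
  simp only [coeff_sum]
  exact HasDerivAt.fun_sum fun i hi => h i hi α

/-- A coefficient that vanishes for all t has zero derivative. This bounds the degree of φ'' without
examining its formula. -/
theorem totalDegree_le {n : ℕ} (h : HasCoeffDerivAt F F' t)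
    (hF : ∀ t, (F t).totalDegree ≤ n) : F'.totalDegree ≤ n := by
  refine Finset.sup_le fun α hα => ?_
  by_contra! hlt
  have hzero : (fun t => coeff α (F t)) = fun _ => 0 := funext fun u =>
    coeff_eq_zero_of_totalDegree_lt ((hF u).trans_lt hlt)
  have hα' := h α
  rw [hzero] at hα'
  exact mem_support_iff.mp hα (hα'.unique (hasDerivAt_const t 0))

end HasCoeffDerivAt

/-! ### Dilations about a point -/

/-- The substitution `x ↦ p + t (x - p)`. -/
def dilate {d : ℕ} (p : Fin d → ℝ) (t : ℝ) :
    MvPolynomial (Fin d) ℝ →ₐ[ℝ] MvPolynomial (Fin d) ℝ :=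
  aeval fun i => C (p i) + C t * (X i - C (p i))

theorem dilate_X {d : ℕ} (p : Fin d → ℝ) (t : ℝ) (i : Fin d) :
    dilate p t (X i) = C (p i) + C t * (X i - C (p i)) := by
  simp [dilate]

theorem dilate_C {d : ℕ} (p : Fin d → ℝ) (t : ℝ) (a : ℝ) : dilate p t (C a) = C a :=
  (dilate p t).commutes a

theorem dilate_one {d : ℕ} (p : Fin d → ℝ) (f : MvPolynomial (Fin d) ℝ) : dilate p 1 f = f := by
  simp [dilate]

theorem dilate_zero {d : ℕ} (p : Fin d → ℝ) (f : MvPolynomial (Fin d) ℝ) :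
    dilate p 0 f = C (eval p f) := by
  have : dilate p 0 = (Algebra.ofId ℝ (MvPolynomial (Fin d) ℝ)).comp (aeval p) := by
    ext i : 1
    simp [dilate, Algebra.ofId_apply, algebraMap_eq]
  rw [this]
  simp [Algebra.ofId_apply, algebraMap_eq, aeval_eq_eval]

theorem totalDegree_dilate_le {d : ℕ} (p : Fin d → ℝ) (t : ℝ) (f : MvPolynomial (Fin d) ℝ) :
    (dilate p t f).totalDegree ≤ f.totalDegree := by
  have hlin : ∀ i, (C (p i) + C t * (X i - C (p i)) : MvPolynomial (Fin d) ℝ).totalDegree ≤ 1 := by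
    intro i
    refine (totalDegree_add _ _).trans (max_le (by simp) ((totalDegree_mul _ _).trans ?_))
    rw [totalDegree_C, zero_add]
    exact (totalDegree_sub _ _).trans (by simp)
  rw [dilate, aeval_def, eval₂_eq']
  refine totalDegree_finsetSum_le fun α hα => ?_
  refine (totalDegree_mul _ _).trans ?_
  rw [algebraMap_eq, totalDegree_C, zero_add]
  refine (totalDegree_finsetProd _ _).trans (le_trans ?_ (le_totalDegree hα))
  rw [Finsupp.sum_fintype _ _ (by simp)]
  refine Finset.sum_le_sum fun i _ => (totalDegree_pow _ _).trans ?_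
  simpa using Nat.mul_le_mul_left (α i) (hlin i)

/-- The chain rule, by induction on `f`; the Leibniz rule handles multiplication by a variable. -/
theorem hasCoeffDerivAt_dilate {d : ℕ} (p : Fin d → ℝ) (f : MvPolynomial (Fin d) ℝ) (t : ℝ) :
    HasCoeffDerivAt (fun t => dilate p t f)
      (∑ i, (X i - C (p i)) * dilate p t (pderiv i f)) t := by
  induction f using MvPolynomial.induction_on with
  | C a => simpa [dilate_C] using HasCoeffDerivAt.const (C a) t
  | add f g hf hg => simpa [mul_add, Finset.sum_add_distrib] using hf.add hg
  | mul_X f i hf =>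
    have hX : HasCoeffDerivAt (fun t => dilate p t (X i)) (X i - C (p i)) t := by
      intro α
      simp only [dilate_X, coeff_add, coeff_C_mul]
      simpa only [id_eq, one_mul] using
        ((hasDerivAt_id t).mul_const (coeff α (X i - C (p i)))).const_add (coeff α (C (p i)))
    have key := hf.mul hX
    simp only [← map_mul] at key
    convert key using 1
    simp only [Derivation.leibniz, pderiv_X, smul_eq_mul, map_add, map_mul, mul_add,
      Finset.sum_add_distrib]
    rw [add_comm]
    congr 1
    · rw [Finset.sum_mul]
      refine Finset.sum_congr rfl fun j _ => ?_
      ring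
    · rw [Finset.sum_eq_single i]
      · simp [mul_comm]
      · intro j _ hj
        simp [hj.symm]
      · simp

/-! ### Riesz functionals and moment matrices -/

/-- The Riesz functional as a linear map. -/
def rieszLinearMap {d ω : ℕ} (y : multiIdx d ω → ℝ) : MvPolynomial (Fin d) ℝ →ₗ[ℝ] ℝ where
  toFun := riesz y
  map_add' f g := by simp [riesz, add_mul, Finset.sum_add_distrib]
  map_smul' c f := by simp [riesz, Finset.mul_sum, mul_assoc]

theorem rieszLinearMap_apply {d ω : ℕ} (y : multiIdx d ω → ℝ) (f : MvPolynomial (Fin d) ℝ) :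
    rieszLinearMap y f = riesz y f := rfl

theorem riesz_monomial {d ω : ℕ} (y : multiIdx d ω → ℝ) (α : multiIdx d ω) (c : ℝ) :
    riesz y (monomial (α : Fin d →₀ ℕ) c) = c * y α := by
  simp [riesz, coeff_monomial]

theorem HasCoeffDerivAt.riesz {d ω : ℕ} (y : multiIdx d ω → ℝ)
    {F : ℝ → MvPolynomial (Fin d) ℝ} {F' : MvPolynomial (Fin d) ℝ} {t : ℝ}
    (h : HasCoeffDerivAt F F' t) :
    HasDerivAt (fun t => SOSProj.riesz y (F t)) (SOSProj.riesz y F') t :=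
  HasDerivAt.fun_sum fun α _ => (h α).mul_const (y α)

/-- The moment matrix `∑_α y_α B_α`. -/
abbrev momentMatrix {d ω : ℕ} (y : multiIdx d ω → ℝ) :
    Matrix (multiIdx d (ω / 2)) (multiIdx d (ω / 2)) ℝ :=
  ∑ α : multiIdx d ω, y α • momentBasis (ω / 2) (α : Fin d →₀ ℕ)

theorem momentMatrix_apply {d ω : ℕ} (y : multiIdx d ω → ℝ) (β γ : multiIdx d (ω / 2)) :
    momentMatrix y β γ = riesz y (monomial ((β : Fin d →₀ ℕ) + (γ : Fin d →₀ ℕ)) 1) := by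
  simp [momentMatrix, Matrix.sum_apply, momentBasis, riesz, coeff_monomial]

/-- The polynomial with the coefficient vector `w`. -/
def polyOfCoeffs {d n : ℕ} (w : multiIdx d n → ℝ) : MvPolynomial (Fin d) ℝ :=
  ∑ β : multiIdx d n, monomial (β : Fin d →₀ ℕ) (w β)

theorem polyOfCoeffs_coeff {d n : ℕ} (q : MvPolynomial (Fin d) ℝ) (hq : q.totalDegree ≤ n) :
    polyOfCoeffs (fun β : multiIdx d n => coeff (β : Fin d →₀ ℕ) q) = q := by
  ext α
  simp only [polyOfCoeffs, coeff_sum, coeff_monomial]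
  by_cases hα : α ∈ multiIdx d n
  · rw [Finset.sum_eq_single ⟨α, hα⟩]
    · simp
    · intro β _ hβ
      exact if_neg fun h => hβ (Subtype.ext h)
    · simp
  · rw [Finset.sum_eq_zero]
    · refine (coeff_eq_zero_of_totalDegree_lt (hq.trans_lt ?_)).symm
      rw [mem_multiIdx, not_le] at hα
      exact hα.trans_eq (Finsupp.sum_fintype α (fun _ m => m) (by simp)).symm
    · intro β _
      exact if_neg fun h : (β : Fin d →₀ ℕ) = α => hα (h ▸ β.2)

theorem dotProduct_momentMatrix_mulVec {d ω : ℕ} (y : multiIdx d ω → ℝ)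
    (w : multiIdx d (ω / 2) → ℝ) :
    w ⬝ᵥ (momentMatrix y).mulVec w = riesz y (polyOfCoeffs w * polyOfCoeffs w) := by
  rw [polyOfCoeffs, Finset.sum_mul_sum, ← rieszLinearMap_apply, map_sum, dotProduct]
  refine Finset.sum_congr rfl fun β _ => ?_
  rw [map_sum, Matrix.mulVec, dotProduct, Finset.mul_sum]
  refine Finset.sum_congr rfl fun γ _ => ?_
  have : monomial (β : Fin d →₀ ℕ) (w β) * monomial (γ : Fin d →₀ ℕ) (w γ) =
      (w β * w γ) • monomial ((β : Fin d →₀ ℕ) + (γ : Fin d →₀ ℕ)) (1 : ℝ) := by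
    simp [monomial_mul, smul_monomial]
  rw [this, map_smul, rieszLinearMap_apply, momentMatrix_apply, smul_eq_mul]
  ring

/-- The quadratic form of the matrix at a coefficient vector is L of the square of that polynomial.
-/
theorem posSemidef_momentMatrix_iff {d ω : ℕ} (y : multiIdx d ω → ℝ) :
    (momentMatrix y).PosSemidef ↔
      ∀ q : MvPolynomial (Fin d) ℝ, q.totalDegree ≤ ω / 2 → 0 ≤ riesz y (q * q) := by
  constructor
  · intro h q hq
    have := h.dotProduct_mulVec_nonneg fun β : multiIdx d (ω / 2) => coeff (β : Fin d →₀ ℕ) q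
    rwa [star_trivial, dotProduct_momentMatrix_mulVec, polyOfCoeffs_coeff q hq] at this
  · intro h
    refine .of_dotProduct_mulVec_nonneg ?_ fun w => ?_
    · ext β γ
      rw [Matrix.conjTranspose_apply, star_trivial, momentMatrix_apply, momentMatrix_apply,
        add_comm]
    · rw [star_trivial, dotProduct_momentMatrix_mulVec]
      refine h _ (totalDegree_finsetSum_le fun β _ => (totalDegree_monomial_le _ _).trans ?_)
      rw [Finsupp.sum_fintype _ _ (by simp)]
      exact (mem_multiIdx _).mp β.2

/-- The vector of moments of the point mass at `x`. -/
def pointMoments {d : ℕ} (ω : ℕ) (x : Fin d → ℝ) : multiIdx d ω → ℝ :=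
  fun α => eval x (monomial (α : Fin d →₀ ℕ) 1)

theorem riesz_pointMoments {d ω : ℕ} (x : Fin d → ℝ) (f : MvPolynomial (Fin d) ℝ)
    (hf : f.totalDegree ≤ ω) : riesz (pointMoments ω x) f = eval x f := by
  conv_rhs => rw [← polyOfCoeffs_coeff f hf, polyOfCoeffs, map_sum]
  refine Finset.sum_congr rfl fun α _ => ?_
  simp [pointMoments, eval_monomial]

theorem totalDegree_mul_self_le {d ω : ℕ} {q : MvPolynomial (Fin d) ℝ}
    (hq : q.totalDegree ≤ ω / 2) : (q * q).totalDegree ≤ ω := by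
  have := totalDegree_mul q q
  omega

theorem pointMoments_mem_momentFeasible {d s ω : ℕ} {g : Fin s → MvPolynomial (Fin d) ℝ}
    (hdeg : ∀ j, (g j).totalDegree ≤ ω) {x : EuclideanSpace ℝ (Fin d)} (hx : x ∈ feasibleSet g) :
    pointMoments ω (fun i => x i) ∈ momentFeasible g ω := by
  refine ⟨fun j => ?_, (posSemidef_momentMatrix_iff _).mpr fun q hq => ?_, ?_⟩
  · rw [riesz_pointMoments _ _ (hdeg j)]
    exact hx j
  · rw [riesz_pointMoments _ _ (totalDegree_mul_self_le hq), map_mul]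
    exact mul_self_nonneg _
  · simp [pointMoments]

theorem convex_momentFeasible {d s : ℕ} (g : Fin s → MvPolynomial (Fin d) ℝ) (ω : ℕ) :
    Convex ℝ (momentFeasible g ω) := by
  intro y hy z hz a b ha hb hab
  have hlin : ∀ f, riesz (a • y + b • z) f = a * riesz y f + b * riesz z f := fun f => by
    simp only [riesz, Finset.mul_sum, ← Finset.sum_add_distrib, Pi.add_apply, Pi.smul_apply,
      smul_eq_mul]
    exact Finset.sum_congr rfl fun α _ => by ring
  refine ⟨fun j => ?_, (posSemidef_momentMatrix_iff _).mpr fun q hq => ?_, ?_⟩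
  · rw [hlin]
    exact add_nonpos (mul_nonpos_of_nonneg_of_nonpos ha (hy.1 j))
      (mul_nonpos_of_nonneg_of_nonpos hb (hz.1 j))
  · rw [hlin]
    exact add_nonneg (mul_nonneg ha ((posSemidef_momentMatrix_iff y).mp hy.2.1 q hq))
      (mul_nonneg hb ((posSemidef_momentMatrix_iff z).mp hz.2.1 q hq))
  · simp [hy.2.2, hz.2.2, hab]

/-! ### Jensen's inequality -/

/-- **Jensen's inequality for SOS-convex polynomials**: it holds for every functional that is
nonnegative on squares, not only for integration against a measure. -/
theorem IsSOSConvex.eval_le_riesz {d ω : ℕ} {f : MvPolynomial (Fin d) ℝ} (hf : IsSOSConvex f)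
    (hω : Even ω) (hω2 : 2 ≤ ω) (hdeg : f.totalDegree ≤ ω) (y : multiIdx d ω → ℝ)
    (hpsd : (momentMatrix y).PosSemidef) (hy0 : y ⟨0, zero_mem_multiIdx d ω⟩ = 1) :
    eval (fun i => y ⟨Finsupp.single i 1, single_mem_multiIdx hω2 i⟩) f ≤ riesz y f := by
  set p : Fin d → ℝ := fun i => y ⟨Finsupp.single i 1, single_mem_multiIdx hω2 i⟩ with hp
  obtain ⟨ν, P, hP⟩ := hf
  have hC : ∀ c, riesz y (C c) = c := fun c => by
    simpa [hy0] using riesz_monomial y ⟨0, zero_mem_multiIdx d ω⟩ c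
  have hX : ∀ i, riesz y (X i) = p i := fun i => by
    simpa [X] using riesz_monomial y ⟨Finsupp.single i 1, single_mem_multiIdx hω2 i⟩ 1
  have hXC : ∀ i c, riesz y ((X i - C (p i)) * C c) = 0 := fun i c => by
    rw [mul_comm, ← smul_eq_C_mul, ← rieszLinearMap_apply, map_smul, map_sub,
      rieszLinearMap_apply, rieszLinearMap_apply, hX, hC, sub_self, smul_zero]
  -- L(`F₁ t`) is φ'(t); the squares of the `q t k` will sum to the derivative of `F₁`.
  let F₁ : ℝ → MvPolynomial (Fin d) ℝ := fun t =>
    ∑ i, (X i - C (p i)) * dilate p t (pderiv i f)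
  let q : ℝ → Fin ν → MvPolynomial (Fin d) ℝ := fun t k =>
    ∑ i, (X i - C (p i)) * dilate p t (P k i)
  have hF : ∀ t, HasCoeffDerivAt (fun t => dilate p t f) (F₁ t) t :=
    hasCoeffDerivAt_dilate p f
  have hF₁ : ∀ t, HasCoeffDerivAt F₁ (∑ k, q t k * q t k) t := by
    intro t
    have hpd : ∀ i j, pderiv j (pderiv i f) = ∑ k, P k i * P k j := fun i j => by
      have := congrFun (congrFun hP j) i
      simp only [hessian, Matrix.of_apply, Matrix.mul_apply, Matrix.transpose_apply] at this
      rw [this]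
      exact Finset.sum_congr rfl fun k _ => mul_comm _ _
    have := HasCoeffDerivAt.sum (s := Finset.univ) fun i _ =>
      (HasCoeffDerivAt.const (X i - C (p i)) t).mul (hasCoeffDerivAt_dilate p (pderiv i f) t)
    convert this using 1
    simp only [q, zero_mul, zero_add, hpd, map_sum, map_mul, Finset.mul_sum, Finset.sum_mul]
    rw [Finset.sum_comm]
    refine Finset.sum_congr rfl fun i _ => ?_
    rw [Finset.sum_comm]
    refine Finset.sum_congr rfl fun j _ => Finset.sum_congr rfl fun k _ => ?_
    ring
  have hdegF₁ : ∀ t, (F₁ t).totalDegree ≤ ω := fun t =>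
    (hF t).totalDegree_le fun u => (totalDegree_dilate_le p u f).trans hdeg
  have hnonneg : ∀ t, 0 ≤ riesz y (∑ k, q t k * q t k) := by
    intro t
    -- The whole sum has degree at most ω, and ω = 2(ω/2) by evenness, so each `q t k` has degree at
    -- most ω/2.
    have hsos := (hF₁ t).totalDegree_le hdegF₁
    rw [← Nat.two_mul_div_two_of_even hω] at hsos
    rw [← rieszLinearMap_apply, map_sum]
    exact Finset.sum_nonneg fun k _ => (posSemidef_momentMatrix_iff y).mp hpsd _
      (totalDegree_le_of_sum_mul_self _ hsos k)
  have hmono : Monotone fun t => riesz y (F₁ t) :=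
    monotone_of_hasDerivAt_nonneg (fun t => (hF₁ t).riesz y) hnonneg
  have hF₁0 : riesz y (F₁ 0) = 0 := by
    simp only [F₁, dilate_zero]
    rw [← rieszLinearMap_apply, map_sum]
    exact Finset.sum_eq_zero fun i _ => hXC i _
  have hderiv : ∀ t, HasDerivAt (fun t => riesz y (dilate p t f)) (riesz y (F₁ t)) t :=
    fun t => (hF t).riesz y
  have hle : riesz y (dilate p 0 f) ≤ riesz y (dilate p 1 f) := by
    refine monotoneOn_of_deriv_nonneg (convex_Icc (0 : ℝ) 1)
      (fun t _ => (hderiv t).continuousAt.continuousWithinAt)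
      (fun t _ => (hderiv t).differentiableAt.differentiableWithinAt) (fun t ht => ?_)
      (by simp) (by simp) zero_le_one
    rw [(hderiv t).deriv, ← hF₁0]
    exact hmono (interior_subset ht).1
  rwa [dilate_zero, dilate_one, hC] at hle

theorem isSOSConvex_distSqPoly {d : ℕ} (v : EuclideanSpace ℝ (Fin d)) :
    IsSOSConvex (distSqPoly v) := by
  refine ⟨d, Matrix.diagonal fun _ => C √2, ?_⟩
  rw [Matrix.diagonal_transpose, Matrix.diagonal_mul_diagonal]
  ext1 i j
  have h1 : pderiv j (distSqPoly v) = C 2 * (X j - C (v j)) := by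
    rw [distSqPoly, map_sum, Finset.sum_eq_single j]
    · simp [show (C 2 : MvPolynomial (Fin d) ℝ) = 2 from rfl]
    · intro k _ hk
      simp [pderiv_X_of_ne hk]
    · simp
  rw [hessian, Matrix.of_apply, h1, pderiv_C_mul, map_sub, pderiv_C, sub_zero, ← C_mul,
    Real.mul_self_sqrt zero_le_two, Matrix.diagonal_apply]
  split_ifs with hij
  · simp [hij]
  · simp [pderiv_X_of_ne (Ne.symm hij)]

theorem totalDegree_distSqPoly_le {d : ℕ} (v : EuclideanSpace ℝ (Fin d)) :
    (distSqPoly v).totalDegree ≤ 2 := by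
  refine totalDegree_finsetSum_le fun i _ => (totalDegree_pow _ _).trans ?_
  have : (X i - C (v i) : MvPolynomial (Fin d) ℝ).totalDegree ≤ 1 :=
    (totalDegree_sub_C_le _ _).trans (by simp)
  omega

/-! ### Feasibility, convexity and uniqueness of the projection -/

/-- The first moments of a feasible point of the moment program are feasible for the original
constraints. -/
theorem firstMoments_mem_feasibleSet {d s ω : ℕ} {g : Fin s → MvPolynomial (Fin d) ℝ}
    (hg : ∀ j, IsSOSConvex (g j)) (hω : Even ω) (hω2 : 2 ≤ ω)
    (hdeg : ∀ j, (g j).totalDegree ≤ ω) {y : multiIdx d ω → ℝ} (hy : y ∈ momentFeasible g ω) :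
    (WithLp.toLp 2 fun i : Fin d => y ⟨Finsupp.single i 1, single_mem_multiIdx hω2 i⟩) ∈
      feasibleSet g :=
  fun j => ((hg j).eval_le_riesz hω hω2 (hdeg j) y hy.2.1 hy.2.2).trans (hy.1 j)

/-- A segment in D is the first-moment image of a segment of feasible moment vectors between two
point masses. -/
theorem convex_feasibleSet {d s ω : ℕ} {g : Fin s → MvPolynomial (Fin d) ℝ}
    (hg : ∀ j, IsSOSConvex (g j)) (hω : Even ω) (hω2 : 2 ≤ ω)
    (hdeg : ∀ j, (g j).totalDegree ≤ ω) : Convex ℝ (feasibleSet g) := by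
  intro x hx z hz a b ha hb hab
  have := firstMoments_mem_feasibleSet hg hω hω2 hdeg
    (convex_momentFeasible g ω (pointMoments_mem_momentFeasible hdeg hx)
      (pointMoments_mem_momentFeasible hdeg hz) ha hb hab)
  convert this using 1
  ext i
  simp [pointMoments, eval_monomial]

theorem subsingleton_projectionSet {d : ℕ} {D : Set (EuclideanSpace ℝ (Fin d))}
    (hD : Convex ℝ D) (v : EuclideanSpace ℝ (Fin d)) : (projectionSet D v).Subsingleton := by
  rintro p ⟨hp, hpmin⟩ z ⟨hz, hzmin⟩
  -- The midpoint of two minimisers is no closer to `v`; the parallelogram law then forces them to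
  -- coincide.
  have hm := hpmin _ (hD hp hz (by norm_num : (0 : ℝ) ≤ 1 / 2) (by norm_num : (0 : ℝ) ≤ 1 / 2)
    (by norm_num))
  have hpz : ‖v - p‖ ^ 2 = ‖v - z‖ ^ 2 := le_antisymm (hpmin z hz) (hzmin p hp)
  have hpar := parallelogram_law_with_norm ℝ (v - p) (v - z)
  have hmid : v - ((1 / 2 : ℝ) • p + (1 / 2 : ℝ) • z) = (1 / 2 : ℝ) • ((v - p) + (v - z)) := by
    module
  rw [hmid, norm_smul, mul_pow] at hm
  norm_num at hm
  have hzero : ‖(v - p) - (v - z)‖ = 0 := by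
    refine pow_eq_zero_iff two_ne_zero |>.mp (le_antisymm ?_ (sq_nonneg _))
    nlinarith
  have := norm_eq_zero.mp hzero
  rw [sub_sub_sub_cancel_left, sub_eq_zero] at this
  exact this.symm

end

end SOSProj

theorem mainTheorem1 (d s : ℕ) (v : EuclideanSpace ℝ (Fin d))
    (g : Fin s → MvPolynomial (Fin d) ℝ) (hg : ∀ j, SOSProj.IsSOSConvex (g j))
    (ω : ℕ) (hω : IsLeast {n : ℕ | Even n ∧ 2 ≤ n ∧ ∀ j, (g j).totalDegree ≤ n} ω)
    (hdual : ∃ μ : ℝ, IsGreatest (SOSProj.sosValues g v ω) μ ∧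
      IsLeast (SOSProj.momentValues g v ω) μ)
    (y : SOSProj.multiIdx d ω → ℝ) (hy : SOSProj.IsMomentSolution g v ω y) :
    SOSProj.projectionSet (SOSProj.feasibleSet g) v =
      {WithLp.toLp 2 fun i : Fin d =>
        y ⟨Finsupp.single i 1, SOSProj.single_mem_multiIdx hω.1.2.1 i⟩} := by
  obtain ⟨hfeas, hmin⟩ := hy
  obtain ⟨heven, hω2, hdeg⟩ := hω.1
  refine (SOSProj.subsingleton_projectionSet
    (SOSProj.convex_feasibleSet hg heven hω2 hdeg) v).eq_singleton_of_mem
    ⟨SOSProj.firstMoments_mem_feasibleSet hg heven hω2 hdeg hfeas, fun x hx => ?_⟩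
  have hdist := (SOSProj.totalDegree_distSqPoly_le v).trans hω2
  have hjensen := (SOSProj.isSOSConvex_distSqPoly v).eval_le_riesz heven hω2 hdist y
    hfeas.2.1 hfeas.2.2
  have hopt := hmin _ (SOSProj.pointMoments_mem_momentFeasible hdeg hx)
  rw [SOSProj.riesz_pointMoments _ _ hdist, SOSProj.eval_distSqPoly] at hopt
  rw [norm_sub_rev v, norm_sub_rev v x, ← SOSProj.eval_distSqPoly]
  exact hjensen.trans hopt
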